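/- Let $(\alpha,\theta)$ be real parameters such that either (1) $\alpha<0$ and $\theta=-k\alpha$ for some integer $k\ge 1$, or (2) $0\le\alpha\le 1$ and $\theta>-\alpha$. Consider the Chinese restaurant process with parameters $(\alpha,\theta)$: there are infinitely many tables; customer $1$ sits at any table; for every $n\ge 1$, given the tables chosen by customers $1,\dots,n$, who occupy $m$ tables, customer $n+1$ sits at a given table with $t\ge 1$ customers with probability $\frac{t-\alpha}{n+\theta}$, and at some empty table with probability $\frac{m\alpha+\theta}{n+\theta}$. Consider the random partition of $\mathbb{N}_+=\{1,2,\dots\}$ whose blocks are the sets of customers sitting at the same table. Let $B_1$ be the block containing $1$ and, for $i\ge 2$, let $B_i$ be the block containing the smallest element not in $B_1\cup\dots\cup B_{i-1}$ (with $B_i=\emptyset$ if there is no such element). Let $$V_i=\lim_{n\to\infty}\frac{|B_i\cap\{1,\dots,n\}|}{n}.$$ Then: (a) Almost surely, the limit $V_i$ exists for every $i\ge 1$. (b) The sequence $(V_1,V_2,\dots)$ has the same law as $(V_1^\star,V_2^\star,\dots)$, where $$V_k^\star=W_k\prod_{j<k}(1-W_j),\qquad k=1,2,\dots,$$ for independent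 random variables $W_1,W_2,\dots$ with $W_j\sim\mathrm{Beta}(1-\alpha,\theta+j\alpha)$. Here, as usual, $\mathrm{Beta}(0,b)$ with $b>0$ is the point mass at $0$ (this occurs only if $\alpha=1$), and $\mathrm{Beta}(a,0)$ with $a>0$ is the point mass at $1$; in case (1), where $\theta+k\alpha=0$, one thus has $W_k=1$, and one also sets $W_j=1$ for $j>k$ (these $W_j$ have no influence, since $V_j^\star=0$ for $j>k$). (c) In case (2), the partition almost surely has infinitely many blocks, and if moreover $\alpha<1$, then almost surely every block $B$ has a positive weight, that is, $\lim_{n\to\infty}|B\cap\{1,\dots,n\}|/n$ exists and is positive. -/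

import Mathlib

namespace CRP

/-- The admissible parameters `(α, θ)`: either `α < 0` and `θ = -kα` for some positive integer `k`,
or `0 ≤ α ≤ 1` and `θ > -α`. -/
def Admissible (α θ : ℝ) : Prop :=
  (α < 0 ∧ ∃ k : ℕ, 0 < k ∧ θ = -(k : ℝ) * α) ∨ (0 ≤ α ∧ α ≤ 1 ∧ -α < θ)

/-- `s c` is the table of customer `c`; customers are numbered `0, 1, 2, …`, so the first `n`
customers are those with `c < n`. This is the number of them sitting at table `j`. -/
def tableSize (s : ℕ → ℕ) (n j : ℕ) : ℕ :=
  ((Finset.range n).filter fun c => s c = j).card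

/-- The number of tables occupied by the first `n` customers. -/
def numTables (s : ℕ → ℕ) (n : ℕ) : ℕ :=
  ((Finset.range n).image s).card

/-- The event that the first `n` customers have chosen the tables `s 0, …, s (n - 1)`. -/
def history {Ω : Type*} (X : ℕ → Ω → ℕ) (n : ℕ) (s : ℕ → ℕ) : Set Ω :=
  {ω | ∀ c < n, X c ω = s c}

/-- `X c` is the table chosen by customer `c` in a Chinese restaurant process with parameters
`(α, θ)`. The tables are labelled by natural numbers; the first customer sits at any table.
Given the tables of the first `n ≥ 1` customers, occupying `m` tables, the next
customer chooses a given table with `t ≥ 1` customers with probability `(t - α) / (n + θ)`,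
and some (no matter which) empty table with probability `(m α + θ) / (n + θ)`. -/
structure IsChineseRestaurant {Ω : Type*} [MeasurableSpace Ω] (μ : MeasureTheory.Measure Ω)
    (α θ : ℝ) (X : ℕ → Ω → ℕ) : Prop where
  measurable : ∀ c, Measurable (X c)
  occupied_table : ∀ n : ℕ, 1 ≤ n → ∀ s : ℕ → ℕ, μ (history X n s) ≠ 0 →
    ∀ j : ℕ, 1 ≤ tableSize s n j →
      (ProbabilityTheory.cond μ (history X n s)).real {ω | X n ω = j}
        = ((tableSize s n j : ℝ) - α) / ((n : ℝ) + θ)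
  empty_table : ∀ n : ℕ, 1 ≤ n → ∀ s : ℕ → ℕ, μ (history X n s) ≠ 0 →
      (ProbabilityTheory.cond μ (history X n s)).real {ω | tableSize s n (X n ω) = 0}
        = ((numTables s n : ℝ) * α + θ) / ((n : ℝ) + θ)

/-- The random partition of `ℕ` generated by the process: two customers are in the same block iff
they sit at the same table. -/
def partition {Ω : Type*} (X : ℕ → Ω → ℕ) (ω : Ω) : Setoid ℕ :=
  Setoid.ker fun c => X c ω

/-- The `i`-th block (`i = 0, 1, 2, …`) of a partition of `ℕ`, in order of least elements: the block
containing the smallest element that lies in none of the blocks `0, …, i - 1`. It is empty if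
these blocks already cover `ℕ`. -/
def block (r : Setoid ℕ) (i : ℕ) : Set ℕ :=
  {c | ∃ m, IsLeast {d | ∀ j, j < i → d ∉ block r j} m ∧ r c m}
termination_by i

/-- The proportion of members of `B` among the first `n` natural numbers. -/
noncomputable def proportion (B : Set ℕ) (n : ℕ) : ℝ :=
  ((B ∩ Set.Iio n).ncard : ℝ) / (n : ℝ)

/-- The weight of a block, the limit of `proportion B n` as `n → ∞` (meaningful if it exists). -/
noncomputable def weight (B : Set ℕ) : ℝ :=
  Filter.limUnder Filter.atTop (proportion B)

/-- The Beta distribution with parameters `a` and `b`, with the usual degenerate limiting cases: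
the point mass at `0` if `a = 0 < b`, the point mass at `1` if `b = 0 < a`. (For `b < 0 < a`, which
occurs in the stick-breaking only after the whole stick has been used up, again
the point mass at `1`.) -/
noncomputable def betaLaw (a b : ℝ) : MeasureTheory.Measure ℝ :=
  if a ≤ 0 then MeasureTheory.Measure.dirac 0
  else if b ≤ 0 then MeasureTheory.Measure.dirac 1
  else ProbabilityTheory.betaMeasure a b

/-- Stick breaking: `w k * (1 - w 0) * … * (1 - w (k - 1))`. -/
def stickBreaking (w : ℕ → ℝ) (k : ℕ) : ℝ :=
  w k * ∏ j ∈ Finset.range k, (1 - w j)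

end CRP

/-!
Label the tables in order of appearance. The block `B_i` is then the set of customers with label
`i`, and the restaurant is described by the random sequence of labels.

The same sequence arises by sampling from random sticks. Given stick-breaking factors
`w 0, w 1, …` in `[0, 1]`, cut the unit interval into pieces of lengths
`w i * ∏ j < i, (1 - w j)`, and throw independent uniform points on it. A customer whose point falls
into a piece with a label already in use receives that label; all others receive the smallest unused
label. Given `w`, the probability of a sequence of labels is a product over its terms, namely
`∏ i, w i ^ (n_i - 1) * (1 - w i) ^ (n_{i+1} + n_{i+2} + ⋯)`, where `n_i` is the number of customers
with label `i` (`prod_pickProb`). Averaging over independent Beta factors gives a product of Beta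
moments. Adding a customer with label `l` multiplies the moments of index `i ≤ l` by quotients which
telescope to the seating probability of the restaurant (`cylinderProb_succ`). Hence the labels in
the restaurant and the sampled labels have the same law (`IsChineseRestaurant.map_labels`).

For the sampled labels everything follows from the strong law of large numbers with `w` fixed. Once
the label `i` is in use, a customer receives it exactly if the point lies in the piece `i`, so that
its frequency is the length of the piece; and if the label `i` is never used, then the earlier
pieces exhaust the interval and this length is zero (`HasFrequencies.tendsto_sample`). If no factor
equals one, which is almost surely the case for `α ≥ 0`, the interval is never exhausted and all
labels occur; if `α < 1` as well, the factors are almost surely positive, and so are the lengths.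
-/

open Filter MeasureTheory ProbabilityTheory Topology

namespace CRP

/-! ### Labelling the tables in order of appearance -/

/-- The index, in order of appearance and starting from `0`, of the table of customer `c`: the
number of tables occupied just before the first customer of that table arrives. -/
def label (s : ℕ → ℕ) (c : ℕ) : ℕ :=
  numTables s (Nat.find (⟨c, rfl⟩ : ∃ d, s d = s c))

theorem tableSize_eq_zero_iff {s : ℕ → ℕ} {n j : ℕ} : tableSize s n j = 0 ↔ ∀ c < n, s c ≠ j := by
  simp [tableSize, Finset.filter_eq_empty_iff]

theorem tableSize_succ (s : ℕ → ℕ) (n j : ℕ) :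
    tableSize s (n + 1) j = tableSize s n j + if s n = j then 1 else 0 := by
  unfold tableSize
  rw [Finset.range_add_one, Finset.filter_insert]
  split_ifs <;> simp

theorem tableSize_congr {s t : ℕ → ℕ} {n : ℕ} (h : ∀ c < n, s c = t c) (j : ℕ) :
    tableSize s n j = tableSize t n j := by
  unfold tableSize
  congr 1
  refine Finset.filter_congr fun c hc => ?_
  rw [h c (Finset.mem_range.1 hc)]

theorem numTables_congr {s t : ℕ → ℕ} {n : ℕ} (h : ∀ c < n, s c = t c) :
    numTables s n = numTables t n := by
  unfold numTables
  congr 1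
  exact Finset.image_congr fun c hc => h c (by simpa using hc)

theorem numTables_mono (s : ℕ → ℕ) : Monotone (numTables s) := fun _ _ h =>
  Finset.card_le_card (Finset.image_subset_image (Finset.range_mono h))

theorem numTables_succ_of_new {s : ℕ → ℕ} {n : ℕ} (h : ∀ c < n, s c ≠ s n) :
    numTables s (n + 1) = numTables s n + 1 := by
  unfold numTables
  rw [Finset.range_add_one, Finset.image_insert, Finset.card_insert_of_notMem]
  simpa using h

theorem label_of_new {s : ℕ → ℕ} {n : ℕ} (h : ∀ c < n, s c ≠ s n) : label s n = numTables s n := by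
  unfold label
  congr 1
  rw [Nat.find_eq_iff]
  exact ⟨rfl, h⟩

theorem label_eq_of_eq {s : ℕ → ℕ} {c d : ℕ} (h : s c = s d) : label s c = label s d := by
  unfold label
  simp only [h]

/-- The label of `c` is the number of tables occupied before the first customer `d` of the same
table. -/
theorem exists_first (s : ℕ → ℕ) (c : ℕ) :
    ∃ d ≤ c, s d = s c ∧ label s c = numTables s d ∧ ∀ e < d, s e ≠ s d := by
  have hex : ∃ d, s d = s c := ⟨c, rfl⟩
  refine ⟨Nat.find hex, Nat.find_min' hex rfl, Nat.find_spec hex, rfl, fun e he h => ?_⟩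
  exact Nat.find_min hex he (h.trans (Nat.find_spec hex))

theorem label_le (s : ℕ → ℕ) (n : ℕ) : label s n ≤ numTables s n := by
  obtain ⟨d, hd, -, h, -⟩ := exists_first s n
  exact h ▸ numTables_mono s hd

theorem label_lt_of_old {s : ℕ → ℕ} {c n : ℕ} (hc : c < n) : label s c < numTables s n := by
  obtain ⟨d, hd, -, h, hnew⟩ := exists_first s c
  rw [h]
  have := numTables_succ_of_new hnew
  have := numTables_mono s (show d + 1 ≤ n by omega)
  omega

theorem label_eq_iff {s : ℕ → ℕ} {c d : ℕ} : label s c = label s d ↔ s c = s d := by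
  refine ⟨fun h => ?_, label_eq_of_eq⟩
  obtain ⟨e, -, he, h1, hne⟩ := exists_first s c
  obtain ⟨f, -, hf, h2, hnf⟩ := exists_first s d
  rcases lt_trichotomy e f with hef | hef | hef
  · have := numTables_succ_of_new hne
    have := numTables_mono s (show e + 1 ≤ f by omega)
    omega
  · rw [← he, ← hf, hef]
  · have := numTables_succ_of_new hnf
    have := numTables_mono s (show f + 1 ≤ e by omega)
    omega

theorem label_congr {s t : ℕ → ℕ} {n : ℕ} (h : ∀ c < n, s c = t c) {c : ℕ} (hc : c < n) :
    label s c = label t c := by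
  obtain ⟨d, hd, he, h1, hnd⟩ := exists_first s c
  have h2 : ∀ e < d, t e ≠ t d := fun e hed => by
    rw [← h e (by omega), ← h d (by omega)]
    exact hnd e hed
  rw [h1, numTables_congr fun e he => h e (by omega), ← label_of_new h2]
  refine label_eq_of_eq ?_
  rw [← h d (by omega), ← h c hc, he]

/-- A sequence `y` is a restricted growth sequence up to time `n` if every value is at most the
number of values taken before. These are the sequences of labels. -/
def RestrictedGrowth (y : ℕ → ℕ) (n : ℕ) : Prop := ∀ c < n, y c ≤ numTables y c

/-- The values of a restricted growth sequence form an initial segment of `ℕ`. -/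
theorem RestrictedGrowth.image_eq {y : ℕ → ℕ} {n : ℕ} (h : RestrictedGrowth y n) :
    (Finset.range n).image y = Finset.range (numTables y n) := by
  induction n with
  | zero => simp [numTables]
  | succ n ih =>
    have ih' := ih fun c hc => h c (by omega)
    have hn := h n (by omega)
    rcases hn.lt_or_eq with hlt | heq
    · have : y n ∈ (Finset.range n).image y := by rw [ih']; simpa using hlt
      have h2 : (Finset.range (n + 1)).image y = (Finset.range n).image y := by
        rw [Finset.range_add_one, Finset.image_insert, Finset.insert_eq_of_mem this]
      have h3 : numTables y (n + 1) = numTables y n := by simp [numTables, h2]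
      rw [h2, h3, ih']
    · have h2 : (Finset.range (n + 1)).image y = Finset.range (numTables y n + 1) := by
        rw [Finset.range_add_one, Finset.image_insert, ih', heq, ← Finset.range_add_one]
      have h3 : numTables y (n + 1) = numTables y n + 1 := by
        conv_lhs => rw [numTables]
        rw [h2, Finset.card_range]
      rw [h2, h3]

theorem RestrictedGrowth.numTables_succ {y : ℕ → ℕ} {n : ℕ} (h : RestrictedGrowth y (n + 1)) :
    numTables y (n + 1) = max (numTables y n) (y n + 1) := by
  have h1 := h.image_eq
  have h2 := RestrictedGrowth.image_eq (y := y) (n := n) fun c hc => h c (by omega)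
  rw [Finset.range_add_one, Finset.image_insert, h2] at h1
  have hn := h n (by omega)
  have key : ∀ i, i < numTables y (n + 1) ↔ i = y n ∨ i < numTables y n := fun i => by
    rw [← Finset.mem_range, ← h1]; simp
  have a := key (numTables y (n + 1))
  have b := key (max (numTables y n) (y n + 1))
  have c := key (max (numTables y n) (y n + 1) - 1)
  omega

/-- Passing to labels does not change the number of occupied tables. -/
theorem numTables_label (s : ℕ → ℕ) (n : ℕ) : numTables (label s) n = numTables s n := by
  induction n with
  | zero => simp [numTables]
  | succ n ih =>
    by_cases h : ∀ c < n, s c ≠ s n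
    · rw [numTables_succ_of_new h, numTables_succ_of_new, ih]
      exact fun c hc h' => h c hc (label_eq_iff.1 h')
    · push Not at h
      obtain ⟨c, hc, hcn⟩ := h
      have aux : ∀ t : ℕ → ℕ, t c = t n → numTables t (n + 1) = numTables t n := fun t ht => by
        unfold numTables
        rw [Finset.range_add_one, Finset.image_insert, Finset.insert_eq_of_mem]
        exact Finset.mem_image.2 ⟨c, by simpa using hc, ht⟩
      rw [aux s hcn, aux _ (label_eq_of_eq hcn), ih]

theorem restrictedGrowth_label (s : ℕ → ℕ) (n : ℕ) : RestrictedGrowth (label s) n := fun c _ => by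
  rw [numTables_label]
  exact label_le s c

theorem exists_label_eq {s : ℕ → ℕ} {n i : ℕ} (h : i < numTables s n) :
    ∃ c < n, label s c = i := by
  have h1 := (restrictedGrowth_label s n).image_eq
  rw [numTables_label] at h1
  have : i ∈ (Finset.range n).image (label s) := by rw [h1]; simpa using h
  simpa using this

theorem tableSize_label (s : ℕ → ℕ) (n c : ℕ) :
    tableSize (label s) n (label s c) = tableSize s n (s c) := by
  simp [tableSize, label_eq_iff]

/-- The `i`-th block of the partition into tables consists of the customers with label `i`. -/
theorem block_ker_eq (s : ℕ → ℕ) (i : ℕ) : block (Setoid.ker s) i = {c | label s c = i} := by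
  induction i using Nat.strong_induction_on with
  | _ i ih =>
    have h1 : {d | ∀ j, j < i → d ∉ block (Setoid.ker s) j} = {d | i ≤ label s d} := by
      ext d
      simp only [Set.mem_ofPred_eq]
      constructor
      · intro h
        by_contra! hlt
        exact h _ hlt (by rw [ih _ hlt]; rfl)
      · intro h j hj hd
        rw [ih j hj] at hd
        simp only [Set.mem_ofPred_eq] at hd
        omega
    have h2 : ∀ m, IsLeast {d | i ≤ label s d} m → label s m = i := by
      intro m hm
      by_contra hne
      have hlt : i < label s m := lt_of_le_of_ne hm.1 (Ne.symm hne)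
      obtain ⟨c, hc, hci⟩ := exists_label_eq (hlt.trans_le (label_le s m))
      have := hm.2 (show c ∈ {d | i ≤ label s d} from hci.ge)
      omega
    rw [block]
    ext c
    simp only [h1, Set.mem_ofPred_eq, Setoid.ker_def]
    constructor
    · rintro ⟨m, hm, hcm⟩
      rw [label_eq_of_eq hcm, h2 m hm]
    · intro hc
      have hne : {d | i ≤ label s d}.Nonempty := ⟨c, hc.ge⟩
      refine ⟨sInf {d | i ≤ label s d}, ?_, ?_⟩
      · exact ⟨Nat.sInf_mem hne, fun d hd => Nat.sInf_le hd⟩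
      · rw [← label_eq_iff, hc, h2]
        exact ⟨Nat.sInf_mem hne, fun d hd => Nat.sInf_le hd⟩

theorem proportion_setOf_eq (z : ℕ → ℕ) (i n : ℕ) :
    proportion {c | z c = i} n = (tableSize z n i : ℝ) / n := by
  unfold proportion tableSize
  congr 2
  rw [← Set.ncard_coe_finset]
  congr 1
  ext c
  simp [and_comm]

/-! ### The law of the labels in the restaurant -/

section Restaurant

variable {Ω : Type*} [MeasurableSpace Ω] {μ : Measure Ω} {α θ : ℝ} {X : ℕ → Ω → ℕ}

/-- The probability that the customer after `n ≥ 1` others with labels `y 0, …, y (n - 1)`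
receives the label `y n`. -/
noncomputable def transition (α θ : ℝ) (y : ℕ → ℕ) (n : ℕ) : ℝ :=
  if y n < numTables y n then ((tableSize y n (y n) : ℝ) - α) / (n + θ)
  else if y n = numTables y n then ((numTables y n : ℝ) * α + θ) / (n + θ)
  else 0

/-- The sequence of labels of the tables chosen by the customers. -/
def labels (X : ℕ → Ω → ℕ) (ω : Ω) : ℕ → ℕ := label fun c => X c ω

theorem measurable_labels (hX : ∀ c, Measurable (X c)) : Measurable (labels X) := by
  refine measurable_pi_iff.2 fun c => ?_
  -- the label of `c` depends on the tables of the first `c + 1` customers only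
  let g : (Fin (c + 1) → ℕ) → ℕ := fun t => label (fun d => if h : d < c + 1 then t ⟨d, h⟩ else 0) c
  have hg : (fun ω => labels X ω c) = g ∘ fun ω (d : Fin (c + 1)) => X d ω := by
    ext ω
    refine label_congr (n := c + 1) (fun d hd => ?_) (by omega)
    simp [hd]
  rw [hg]
  exact (measurable_of_countable g).comp (measurable_pi_iff.2 fun d => hX d)

/-- The event that the first `n` terms of the random sequence `Y` are `y 0, …, y (n - 1)`. -/
def cylinderEvent (Y : Ω → ℕ → ℕ) (n : ℕ) (y : ℕ → ℕ) : Set Ω := {ω | ∀ c < n, Y ω c = y c}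

theorem measurableSet_cylinderEvent {Y : Ω → ℕ → ℕ} (hY : Measurable Y) (n : ℕ) (y : ℕ → ℕ) :
    MeasurableSet (cylinderEvent Y n y) := by
  have : cylinderEvent Y n y = ⋂ c, ⋂ (_ : c < n), {ω | Y ω c = y c} := by
    ext; simp [cylinderEvent]
  rw [this]
  refine MeasurableSet.iInter fun c => MeasurableSet.iInter fun _ => ?_
  exact (measurable_pi_iff.1 hY c) (measurableSet_singleton (y c))

theorem measurableSet_history (hX : ∀ c, Measurable (X c)) (n : ℕ) (s : ℕ → ℕ) :
    MeasurableSet (history X n s) := by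
  have := measurableSet_cylinderEvent (Y := fun ω c => X c ω) (measurable_pi_iff.2 hX) n s
  exact this

/-- One step of the restaurant, given the complete table choices `s` of the first `n` customers.
The conditional probability is expressed through their labels `y` alone. -/
theorem IsChineseRestaurant.history_step [IsProbabilityMeasure μ]
    (hX : IsChineseRestaurant μ α θ X) {n : ℕ} (hn : 1 ≤ n) {s y : ℕ → ℕ}
    (hs : ∀ c < n, label s c = y c) :
    μ.real (history X n s ∩ {ω | labels X ω n = y n})
      = transition α θ y n * μ.real (history X n s) := by
  by_cases h0 : μ (history X n s) = 0
  · rw [measureReal_def, measureReal_def, h0, measure_mono_null Set.inter_subset_left h0]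
    simp
  have hm : numTables y n = numTables s n := by
    rw [← numTables_label s, numTables_congr hs]
  have hmeas := measurableSet_history hX.measurable n s
  have hcond : ∀ E : Set Ω, (cond μ (history X n s)).real E * μ.real (history X n s)
      = μ.real (history X n s ∩ E) := fun E => by
    rw [measureReal_def, measureReal_def, measureReal_def, ← ENNReal.toReal_mul,
      cond_mul_eq_inter hmeas]
  -- on the event `history X n s`, the labels before time `n` are those of `s`
  have hold : ∀ ω ∈ history X n s, ∀ c < n,
      (labels X ω n = label s c ↔ X n ω = s c) := fun ω hω c hc => by
    have h1 : labels X ω c = label s c := label_congr (n := n) hω hc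
    rw [← h1]
    unfold labels
    rw [label_eq_iff, hω c hc]
  have hnum : ∀ ω ∈ history X n s, numTables (fun c => X c ω) n = numTables s n :=
    fun ω hω => numTables_congr hω
  unfold transition
  split_ifs with h1 h2
  · obtain ⟨c, hc, hcy⟩ := exists_label_eq (hm ▸ h1)
    have hsz : tableSize y n (y n) = tableSize s n (s c) := by
      rw [← hcy, ← tableSize_label s n c, tableSize_congr hs]
    have hpos : 1 ≤ tableSize s n (s c) := by
      by_contra hlt
      exact tableSize_eq_zero_iff.1 (by omega : tableSize s n (s c) = 0) c hc rfl
    rw [hsz, ← hX.occupied_table n hn s h0 (s c) hpos, hcond]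
    congr 1
    ext ω
    simp only [Set.mem_inter_iff, Set.mem_ofPred_eq, and_congr_right_iff]
    intro hω
    rw [← hcy, hold ω hω c hc]
  · rw [hm, ← hX.empty_table n hn s h0, hcond]
    congr 1
    ext ω
    simp only [Set.mem_inter_iff, Set.mem_ofPred_eq, and_congr_right_iff]
    intro hω
    rw [tableSize_eq_zero_iff, h2, hm]
    constructor
    · intro h c hc hcn
      have := label_lt_of_old (s := s) hc
      have := (hold ω hω c hc).2 hcn.symm
      omega
    · intro h
      rw [labels, label_of_new, hnum ω hω]
      intro c hc
      have : X c ω = s c := hω c hc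
      rw [this]
      exact h c hc
  · rw [zero_mul]
    convert measureReal_empty
    ext ω
    simp only [Set.mem_inter_iff, Set.mem_ofPred_eq, Set.mem_empty_iff_false, iff_false, not_and]
    intro hω h
    have := label_le (fun c => X c ω) n
    rw [hnum ω hω] at this
    unfold labels at h
    omega

/-- The conditional probability of the next label depends on the past labels only: sum
`IsChineseRestaurant.history_step` over the countably many table choices that have these labels. -/
theorem IsChineseRestaurant.cylinder_step [IsProbabilityMeasure μ]
    (hX : IsChineseRestaurant μ α θ X) {n : ℕ} (hn : 1 ≤ n) (y : ℕ → ℕ) :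
    μ.real (cylinderEvent (labels X) (n + 1) y)
      = transition α θ y n * μ.real (cylinderEvent (labels X) n y) := by
  -- extend the table choices of the first `n` customers by zero to a sequence
  let ext0 : (Fin n → ℕ) → ℕ → ℕ := fun t d => if h : d < n then t ⟨d, h⟩ else 0
  let f : Ω → Fin n → ℕ := fun ω d => X d ω
  have hf : Measurable f := measurable_pi_iff.2 fun d => hX.measurable d
  let A : Set (Fin n → ℕ) := {t | ∀ c < n, label (ext0 t) c = y c}
  have hfib : ∀ t, f ⁻¹' {t} = history X n (ext0 t) := fun t => by
    ext ω
    simp only [Set.mem_preimage, Set.mem_singleton_iff, history, Set.mem_ofPred_eq, funext_iff,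
      Fin.forall_iff, f, ext0]
    refine forall₂_congr fun c hc => ?_
    simp [hc]
  have hA : cylinderEvent (labels X) n y = f ⁻¹' A := by
    ext ω
    simp only [cylinderEvent, Set.mem_ofPred_eq, Set.mem_preimage, A]
    refine forall₂_congr fun c hc => ?_
    have : labels X ω c = label (ext0 (f ω)) c :=
      label_congr (n := n) (fun d hd => by simp [ext0, f, hd]) hc
    rw [this]
  have hsum : ∀ E : Set Ω, MeasurableSet E →
      HasSum (fun t : A => μ.real (history X n (ext0 t) ∩ E)) (μ.real (f ⁻¹' A ∩ E)) := by
    intro E hE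
    have h1 := tsum_measure_preimage_singleton (μ := μ.restrict E) (s := A) (Set.to_countable A)
      (f := f) fun t _ => hf (measurableSet_singleton t)
    have h2 : ∀ B : Set (Fin n → ℕ), (μ.restrict E) (f ⁻¹' B) = μ (f ⁻¹' B ∩ E) := fun B =>
      Measure.restrict_apply (hf B.to_countable.measurableSet)
    simp only [h2] at h1
    simp only [hfib] at h1
    have hne : ∑' t : A, μ (history X n (ext0 t) ∩ E) ≠ ⊤ := by
      rw [h1]
      exact measure_ne_top _ _
    have h3 := ENNReal.hasSum_toReal hne
    rw [← ENNReal.tsum_toReal_eq (fun t => measure_ne_top _ _), h1] at h3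
    exact h3
  have hstep : cylinderEvent (labels X) (n + 1) y = f ⁻¹' A ∩ {ω | labels X ω n = y n} := by
    rw [← hA]
    ext ω
    simp [cylinderEvent, Nat.le_iff_lt_or_eq, or_imp, forall_and]
  have hE : MeasurableSet {ω | labels X ω n = y n} :=
    (measurable_pi_iff.1 (measurable_labels hX.measurable) n) (measurableSet_singleton (y n))
  have s1 := hsum _ hE
  have s2 := (hsum _ MeasurableSet.univ).mul_left (transition α θ y n)
  simp only [Set.inter_univ] at s2
  rw [hstep, hA]
  have hfun : (fun t : A => μ.real (history X n (ext0 t) ∩ {ω | labels X ω n = y n}))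
      = fun t : A => transition α θ y n * μ.real (history X n (ext0 t)) :=
    funext fun t => hX.history_step hn t.2
  rw [hfun] at s1
  exact s1.unique s2

end Restaurant

/-! ### Moments of the Beta distributions -/

instance isProbabilityMeasure_betaLaw (a b : ℝ) : IsProbabilityMeasure (betaLaw a b) := by
  unfold betaLaw
  split_ifs with h1 h2
  · infer_instance
  · infer_instance
  · exact isProbabilityMeasureBeta (not_le.1 h1) (not_le.1 h2)

theorem ae_betaMeasure (a b : ℝ) : ∀ᵐ x ∂betaMeasure a b, 0 < x ∧ x < 1 := by
  unfold betaMeasure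
  rw [ae_withDensity_iff (by unfold betaPDF; fun_prop)]
  refine Eventually.of_forall fun x hx => ?_
  constructor
  · by_contra! h
    exact hx (betaPDF_eq_zero_of_nonpos h)
  · by_contra! h
    exact hx (betaPDF_eq_zero_of_one_le h)

theorem ae_betaLaw_mem (a b : ℝ) : ∀ᵐ x ∂betaLaw a b, 0 ≤ x ∧ x ≤ 1 := by
  unfold betaLaw
  split_ifs with h1 h2
  · rw [ae_dirac_eq]; simp
  · rw [ae_dirac_eq]; simp
  · filter_upwards [ae_betaMeasure a b] with x hx using ⟨hx.1.le, hx.2.le⟩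

theorem ae_betaLaw_pos {a b : ℝ} (ha : 0 < a) : ∀ᵐ x ∂betaLaw a b, 0 < x := by
  unfold betaLaw
  split_ifs with h1 h2
  · exact absurd h1 (not_le.2 ha)
  · rw [ae_dirac_eq]; simp
  · filter_upwards [ae_betaMeasure a b] with x hx using hx.1

theorem ae_betaLaw_lt_one {a b : ℝ} (hb : 0 < b) : ∀ᵐ x ∂betaLaw a b, x < 1 := by
  unfold betaLaw
  split_ifs with h1 h2
  · rw [ae_dirac_eq]; simp
  · exact absurd h2 (not_le.2 hb)
  · filter_upwards [ae_betaMeasure a b] with x hx using hx.2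

/-- The mixed moment `𝔼[x ^ p * (1 - x) ^ q]` of the Beta distribution. -/
noncomputable def betaMoment (a b : ℝ) (p q : ℕ) : ℝ := ∫ x, x ^ p * (1 - x) ^ q ∂betaLaw a b

theorem integrable_betaMoment (a b : ℝ) (p q : ℕ) :
    Integrable (fun x : ℝ => x ^ p * (1 - x) ^ q) (betaLaw a b) := by
  refine Integrable.of_bound (C := 1) (by fun_prop) ?_
  filter_upwards [ae_betaLaw_mem a b] with x hx
  rw [Real.norm_eq_abs, abs_le]
  have h1 := pow_nonneg hx.1 p
  have h2 := pow_le_one₀ hx.1 hx.2 (n := p)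
  have h3 := pow_nonneg (sub_nonneg.2 hx.2) q
  have h4 := pow_le_one₀ (sub_nonneg.2 hx.2) (by linarith [hx.1]) (n := q)
  constructor
  · nlinarith [mul_nonneg h1 h3]
  · exact mul_le_one₀ h2 h3 h4

theorem betaMoment_zero (a b : ℝ) : betaMoment a b 0 0 = 1 := by
  simp [betaMoment]

theorem betaMoment_of_nonpos_left {a : ℝ} (ha : a ≤ 0) (b : ℝ) (p q : ℕ) :
    betaMoment a b p q = 0 ^ p := by
  simp [betaMoment, betaLaw, ha]

theorem betaMoment_of_nonpos_right {a b : ℝ} (ha : 0 < a) (hb : b ≤ 0) (p q : ℕ) :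
    betaMoment a b p q = 0 ^ q := by
  simp [betaMoment, betaLaw, not_le.2 ha, hb]

/-- Multiplying the density of a Beta distribution by `x ^ p * (1 - x) ^ q` gives a multiple of the
density of another Beta distribution. -/
theorem betaMoment_eq_beta {a b : ℝ} (ha : 0 < a) (hb : 0 < b) (p q : ℕ) :
    betaMoment a b p q = beta (a + p) (b + q) / beta a b := by
  have hB := beta_pos ha hb
  have hap : 0 < a + p := by positivity
  have hbq : 0 < b + q := by positivity
  have hB' := beta_pos hap hbq
  have hnn : ∀ a b : ℝ, 0 < a → 0 < b → ∀ x, 0 ≤ betaPDFReal a b x := fun a b ha hb x => by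
    by_cases hx : 0 < x ∧ x < 1
    · exact (betaPDFReal_pos hx.1 hx.2 ha hb).le
    · simp [betaPDFReal, hx]
  have hone : ∫ x, betaPDFReal (a + p) (b + q) x = 1 := by
    rw [integral_eq_lintegral_of_nonneg_ae (Eventually.of_forall (hnn _ _ hap hbq))
      (by fun_prop)]
    have := lintegral_betaPDF_eq_one hap hbq
    unfold betaPDF at this
    rw [this, ENNReal.toReal_one]
  rw [betaMoment, betaLaw, if_neg (not_le.2 ha), if_neg (not_le.2 hb), betaMeasure,
    integral_withDensity_eq_integral_toReal_smul (by unfold betaPDF; fun_prop)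
      (Eventually.of_forall fun x => by simp [betaPDF])]
  have : ∀ x : ℝ, (betaPDF a b x).toReal • (x ^ p * (1 - x) ^ q)
      = beta (a + p) (b + q) / beta a b * betaPDFReal (a + p) (b + q) x := fun x => by
    rw [betaPDF, ENNReal.toReal_ofReal (hnn a b ha hb x), smul_eq_mul]
    unfold betaPDFReal
    split_ifs with hx
    · have hx1 : 0 < 1 - x := by linarith [hx.2]
      rw [show a + p - 1 = (a - 1) + p by ring, show b + q - 1 = (b - 1) + q by ring,
        Real.rpow_add hx.1, Real.rpow_add hx1, Real.rpow_natCast, Real.rpow_natCast]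
      field_simp
    · simp
  simp_rw [this]
  rw [integral_const_mul, hone, mul_one]

theorem betaMoment_add (a b : ℝ) (p q : ℕ) :
    betaMoment a b (p + 1) q + betaMoment a b p (q + 1) = betaMoment a b p q := by
  unfold betaMoment
  rw [← integral_add (integrable_betaMoment a b _ _) (integrable_betaMoment a b _ _)]
  congr 1
  ext x
  ring

theorem betaMoment_succ_left {a b : ℝ} (ha : 0 ≤ a) (hb : 0 ≤ b) (hab : 0 < a + b) (p q : ℕ) :
    (a + b + p + q) * betaMoment a b (p + 1) q = (a + p) * betaMoment a b p q := by
  rcases ha.eq_or_lt with rfl | ha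
  · rw [betaMoment_of_nonpos_left le_rfl, betaMoment_of_nonpos_left le_rfl]
    rcases p with _ | p <;> simp
  rcases hb.eq_or_lt with rfl | hb
  · rw [betaMoment_of_nonpos_right ha le_rfl, betaMoment_of_nonpos_right ha le_rfl]
    rcases q with _ | q <;> simp
  have hap : 0 < a + p := by positivity
  have hbq : 0 < b + q := by positivity
  have hB := beta_pos ha hb
  have hG := Real.Gamma_pos_of_pos (add_pos hap hbq)
  rw [betaMoment_eq_beta ha hb, betaMoment_eq_beta ha hb]
  have h1 : beta (a + (p + 1 : ℕ)) (b + q) * (a + p + (b + q)) = (a + p) * beta (a + p) (b + q) := by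
    unfold beta
    rw [show a + ((p + 1 : ℕ) : ℝ) = a + p + 1 by push_cast; ring,
      show a + p + 1 + (b + q) = a + p + (b + q) + 1 by ring,
      Real.Gamma_add_one hap.ne', Real.Gamma_add_one (add_pos hap hbq).ne']
    have := (add_pos hap hbq).ne'
    field_simp
  field_simp
  linarith

theorem betaMoment_succ_right {a b : ℝ} (ha : 0 ≤ a) (hb : 0 ≤ b) (hab : 0 < a + b) (p q : ℕ) :
    (a + b + p + q) * betaMoment a b p (q + 1) = (b + q) * betaMoment a b p q := by
  have h1 := betaMoment_succ_left ha hb hab p q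
  have h2 := betaMoment_add a b p q
  linear_combination (a + b + p + q) * h2 - h1

/-! ### The cylinder probabilities as products of Beta moments -/

/-- The number of the first `n` terms of `y` that are greater than or equal to `i`. -/
def tailSize (y : ℕ → ℕ) (n i : ℕ) : ℕ := ((Finset.range n).filter fun c => i ≤ y c).card

theorem tailSize_zero (y : ℕ → ℕ) (n : ℕ) : tailSize y n 0 = n := by simp [tailSize]

theorem tailSize_succ (y : ℕ → ℕ) (n i : ℕ) :
    tailSize y (n + 1) i = tailSize y n i + if i ≤ y n then 1 else 0 := by
  unfold tailSize
  rw [Finset.range_add_one, Finset.filter_insert]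
  split_ifs <;> simp

theorem tailSize_eq_add (y : ℕ → ℕ) (n i : ℕ) :
    tailSize y n i = tableSize y n i + tailSize y n (i + 1) := by
  unfold tailSize tableSize
  rw [← Finset.card_union_of_disjoint]
  · congr 1
    ext c
    simp only [Finset.mem_filter, Finset.mem_union, Finset.mem_range]
    omega
  · rw [Finset.disjoint_filter]
    intro c _ h1 h2
    omega

theorem RestrictedGrowth.of_succ {y : ℕ → ℕ} {n : ℕ} (h : RestrictedGrowth y (n + 1)) :
    RestrictedGrowth y n := fun c hc => h c (by omega)

theorem RestrictedGrowth.lt_numTables {y : ℕ → ℕ} {n c : ℕ} (h : RestrictedGrowth y n)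
    (hc : c < n) : y c < numTables y n := by
  have : y c ∈ (Finset.range n).image y := Finset.mem_image_of_mem _ (by simpa using hc)
  rw [h.image_eq] at this
  simpa using this

theorem RestrictedGrowth.tableSize_pos {y : ℕ → ℕ} {n i : ℕ} (h : RestrictedGrowth y n)
    (hi : i < numTables y n) : 0 < tableSize y n i := by
  have : i ∈ (Finset.range n).image y := by rw [h.image_eq]; simpa using hi
  obtain ⟨c, hc, hci⟩ := Finset.mem_image.1 this
  exact Finset.card_pos.2 ⟨c, Finset.mem_filter.2 ⟨hc, hci⟩⟩

theorem RestrictedGrowth.tableSize_eq_zero {y : ℕ → ℕ} {n i : ℕ} (h : RestrictedGrowth y n)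
    (hi : numTables y n ≤ i) : tableSize y n i = 0 := by
  rw [tableSize_eq_zero_iff]
  intro c hc
  have := h.lt_numTables hc
  omega

theorem RestrictedGrowth.tailSize_eq_zero {y : ℕ → ℕ} {n i : ℕ} (h : RestrictedGrowth y n)
    (hi : numTables y n ≤ i) : tailSize y n i = 0 := by
  unfold tailSize
  rw [Finset.card_eq_zero, Finset.filter_eq_empty_iff]
  intro c hc
  have := h.lt_numTables (Finset.mem_range.1 hc)
  omega

/-- The first customer of a table does not count in the exponent `tableSize y n i - 1`. -/
theorem RestrictedGrowth.tableSize_sub_one_succ {y : ℕ → ℕ} {n : ℕ}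
    (h : RestrictedGrowth y (n + 1)) (i : ℕ) :
    tableSize y (n + 1) i - 1
      = tableSize y n i - 1 + if i = y n ∧ i < numTables y n then 1 else 0 := by
  rw [tableSize_succ]
  by_cases hi : y n = i
  · by_cases hlt : i < numTables y n
    · have := h.of_succ.tableSize_pos hlt
      rw [if_pos hi, if_pos ⟨hi.symm, hlt⟩]
      omega
    · have := h.of_succ.tableSize_eq_zero (not_lt.1 hlt)
      rw [if_pos hi, if_neg fun h => hlt h.2]
      omega
  · rw [if_neg hi, if_neg fun h => hi h.1.symm, add_zero, add_zero]

theorem prod_range_ite_lt {K l : ℕ} (hl : l ≤ K) (f : ℕ → ℝ) :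
    ∏ i ∈ Finset.range K, (if i < l then f i else 1) = ∏ i ∈ Finset.range l, f i := by
  rw [← Finset.prod_filter]
  congr 1
  ext i
  simp only [Finset.mem_filter, Finset.mem_range]
  omega

theorem prod_range_succ_div {D : ℕ → ℝ} {l : ℕ} (hD : ∀ i < l, D i ≠ 0) (h0 : D 0 ≠ 0) :
    ∏ i ∈ Finset.range l, D (i + 1) / D i = D l / D 0 := by
  induction l with
  | zero => simp [h0]
  | succ l ih =>
    rw [Finset.prod_range_succ, ih fun i hi => hD i (by omega)]
    have := hD l (by omega)
    field_simp

/-- The probability that the first `n` labels are given by the restricted growth sequence `y`: the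
block with label `i` contributes a moment of its stick-breaking factor. The labels have to be
smaller than the cut-off `K`. -/
noncomputable def cylinderProb (α θ : ℝ) (K : ℕ) (y : ℕ → ℕ) (n : ℕ) : ℝ :=
  ∏ i ∈ Finset.range K,
    betaMoment (1 - α) (θ + ((i : ℝ) + 1) * α) (tableSize y n i - 1) (tailSize y n (i + 1))

/-- In the case of finitely many sticks, sequences with too many labels have probability zero. -/
theorem cylinderProb_eq_zero {α θ : ℝ} (hα : α < 0) {k : ℕ} (hk : 0 < k) (hθ : θ = -(k : ℝ) * α)
    {K : ℕ} {y : ℕ → ℕ} {n : ℕ} (hK : k ≤ K) (h : 0 < tailSize y n k) :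
    cylinderProb α θ K y n = 0 := by
  refine Finset.prod_eq_zero (i := k - 1) (Finset.mem_range.2 (by omega)) ?_
  rw [betaMoment_of_nonpos_right (by linarith), Nat.sub_add_cancel hk]
  · exact zero_pow h.ne'
  · rw [hθ, Nat.cast_sub hk]
    push_cast
    linarith

theorem Admissible.add_pos {α θ : ℝ} (h : Admissible α θ) : 0 < θ + 1 := by
  rcases h with ⟨hα, k, hk, rfl⟩ | ⟨h0, h1, h2⟩
  · have : (0 : ℝ) < k := by exact_mod_cast hk
    nlinarith
  · linarith

theorem Admissible.le_one {α θ : ℝ} (h : Admissible α θ) : α ≤ 1 := by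
  rcases h with ⟨hα, -⟩ | ⟨-, h1, -⟩ <;> linarith

/-- The product of Beta moments follows the seating rule of the restaurant: adding a customer with
label `l` multiplies the moments with index `i ≤ l` by quotients that telescope. -/
theorem cylinderProb_succ {α θ : ℝ} (hαθ : Admissible α θ) {K : ℕ} {y : ℕ → ℕ} {n : ℕ}
    (hn : 1 ≤ n) (hy : RestrictedGrowth y (n + 1)) (hK : numTables y (n + 1) ≤ K) :
    cylinderProb α θ K y (n + 1) = transition α θ y n * cylinderProb α θ K y n := by
  have hy' := hy.of_succ
  set m := numTables y n with hm
  have hmK : m ≤ K := (numTables_mono y n.le_succ).trans hK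
  have hlm : y n ≤ m := hy n (by omega)
  have hlK : y n < K := (hy.lt_numTables (by omega)).trans_le hK
  by_cases hpos : ∀ i < m, 0 ≤ θ + ((i : ℝ) + 1) * α
  · let D : ℕ → ℝ := fun i => θ + i * α + tailSize y n i
    have hsum : ∀ i < m, 0 < (1 - α) + (θ + ((i : ℝ) + 1) * α) := fun i hi => by
      rcases i with _ | i
      · have := hαθ.add_pos
        push_cast
        linarith
      · have := hpos i (by omega)
        push_cast
        linarith
    have hDeq : ∀ i < m, (1 - α) + (θ + ((i : ℝ) + 1) * α) + ((tableSize y n i - 1 : ℕ) : ℝ)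
        + tailSize y n (i + 1) = D i := fun i hi => by
      have := hy'.tableSize_pos hi
      simp only [D]
      rw [tailSize_eq_add y n i, Nat.cast_sub this]
      push_cast
      ring
    have hDpos : ∀ i < m, 0 < D i := fun i hi => by
      rw [← hDeq i hi]
      have := hsum i hi
      positivity
    have hm1 : 0 < m := by
      have := hy'.lt_numTables (c := 0) (by omega)
      omega
    have hD0 : D 0 = n + θ := by simp only [D, tailSize_zero]; push_cast; ring
    let e : ℝ := if y n < m then ((tableSize y n (y n) : ℝ) - α) / D (y n) else 1
    let r : ℕ → ℝ := fun i => (if i < y n then D (i + 1) / D i else 1) * if i = y n then e else 1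
    have hstep : ∀ i : ℕ, betaMoment (1 - α) (θ + ((i : ℝ) + 1) * α) (tableSize y (n + 1) i - 1)
          (tailSize y (n + 1) (i + 1))
        = r i * betaMoment (1 - α) (θ + ((i : ℝ) + 1) * α) (tableSize y n i - 1)
          (tailSize y n (i + 1)) := fun i => by
      rw [hy.tableSize_sub_one_succ, tailSize_succ]
      simp only [r, e, Nat.add_one_le_iff]
      rcases lt_trichotomy i (y n) with hi | hi | hi
      · have him : i < m := by omega
        rw [if_neg (by omega), if_pos hi, if_pos hi, if_neg hi.ne, mul_one, add_zero]
        have h1 := betaMoment_succ_right (by linarith [hαθ.le_one]) (hpos i him) (hsum i him)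
          (tableSize y n i - 1) (tailSize y n (i + 1))
        rw [hDeq i him] at h1
        have h2 : θ + ((i : ℝ) + 1) * α + tailSize y n (i + 1) = D (i + 1) := by
          simp only [D]; push_cast; ring
        rw [h2] at h1
        rw [div_mul_eq_mul_div, eq_div_iff (hDpos i him).ne']
        linarith
      · by_cases hlt : y n < m
        · have him : i < m := by omega
          rw [if_pos ⟨hi, him⟩, if_neg (by omega), if_neg (by omega), if_pos hi, if_pos hlt,
            one_mul, add_zero]
          have h1 := betaMoment_succ_left (by linarith [hαθ.le_one]) (hpos i him) (hsum i him)
            (tableSize y n i - 1) (tailSize y n (i + 1))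
          rw [hDeq i him] at h1
          have h2 : 1 - α + ((tableSize y n i - 1 : ℕ) : ℝ) = tableSize y n (y n) - α := by
            rw [Nat.cast_sub (hy'.tableSize_pos him), hi]
            push_cast
            ring
          rw [h2] at h1
          rw [← hi] at h1 ⊢
          rw [div_mul_eq_mul_div, eq_div_iff (hDpos i him).ne']
          linarith
        · rw [if_neg (by omega), if_neg (by omega), if_neg (by omega), if_pos hi, if_neg hlt]
          simp
      · rw [if_neg (by omega), if_neg (by omega), if_neg (by omega), if_neg (by omega)]
        simp
    have hprod : ∏ i ∈ Finset.range K, r i = transition α θ y n := by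
      simp only [r]
      rw [Finset.prod_mul_distrib, prod_range_ite_lt hlK.le, Finset.prod_ite_eq',
        if_pos (Finset.mem_range.2 hlK),
        prod_range_succ_div (fun i hi => (hDpos i (by omega)).ne') (hDpos 0 hm1).ne', hD0]
      simp only [e, transition, ← hm]
      split_ifs with h1 h2
      · have := (hDpos _ h1).ne'
        field_simp
      · simp only [D]
        rw [h2, hy'.tailSize_eq_zero le_rfl]
        push_cast
        ring
      · omega
    unfold cylinderProb
    rw [← hprod, ← Finset.prod_mul_distrib]
    exact Finset.prod_congr rfl fun i _ => hstep i
  · -- a negative parameter occurs only if more labels are used than there are sticks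
    push Not at hpos
    obtain ⟨i, him, hi⟩ := hpos
    rcases hαθ with ⟨hα, k, hk, hθ⟩ | ⟨h0, h1, h2⟩
    · have hki : k ≤ i := by
        by_contra! hlt
        have : ((i : ℝ) + 1) ≤ k := by exact_mod_cast hlt
        nlinarith
      have htail : 0 < tailSize y n k := by
        rw [tailSize_eq_add]
        have := hy'.tableSize_pos (i := k) (by omega)
        omega
      have htail' : 0 < tailSize y (n + 1) k := by
        rw [tailSize_succ]
        omega
      rw [cylinderProb_eq_zero hα hk hθ (by omega) htail,
        cylinderProb_eq_zero hα hk hθ (by omega) htail', mul_zero]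
    · have : (0 : ℝ) ≤ i := Nat.cast_nonneg i
      nlinarith [mul_nonneg this h0]

theorem cylinderProb_one {α θ : ℝ} {K : ℕ} {y : ℕ → ℕ} (hy : y 0 = 0) :
    cylinderProb α θ K y 1 = 1 := by
  refine Finset.prod_eq_one fun i _ => ?_
  have h1 : tableSize y 1 i - 1 = 0 := by
    have : tableSize y 1 i ≤ 1 := (Finset.card_filter_le _ _).trans (by simp)
    omega
  have h2 : tailSize y 1 (i + 1) = 0 := by simp [tailSize, hy]
  rw [h1, h2, betaMoment_zero]

/-! ### Stick breaking and sampling from the sticks -/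

/-- The length of the stick that remains after `i` pieces have been broken off. -/
def remaining (w : ℕ → ℝ) (i : ℕ) : ℝ := ∏ j ∈ Finset.range i, (1 - w j)

theorem remaining_succ (w : ℕ → ℝ) (i : ℕ) : remaining w (i + 1) = remaining w i * (1 - w i) :=
  Finset.prod_range_succ _ _

theorem stickBreaking_eq_sub (w : ℕ → ℝ) (i : ℕ) :
    stickBreaking w i = remaining w i - remaining w (i + 1) := by
  rw [remaining_succ, stickBreaking, remaining]
  ring

theorem remaining_zero (w : ℕ → ℝ) : remaining w 0 = 1 := by simp [remaining]

theorem remaining_nonneg {w : ℕ → ℝ} (hw : ∀ i, 0 ≤ w i ∧ w i ≤ 1) (i : ℕ) : 0 ≤ remaining w i :=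
  Finset.prod_nonneg fun j _ => sub_nonneg.2 (hw j).2

theorem remaining_antitone {w : ℕ → ℝ} (hw : ∀ i, 0 ≤ w i ∧ w i ≤ 1) : Antitone (remaining w) := by
  refine antitone_nat_of_succ_le fun i => ?_
  rw [remaining_succ]
  exact mul_le_of_le_one_right (remaining_nonneg hw i) (by linarith [(hw i).1])

theorem measurable_remaining (i : ℕ) : Measurable fun w : ℕ → ℝ => remaining w i := by
  unfold remaining
  fun_prop

theorem measurable_stickBreaking : Measurable stickBreaking := by
  refine measurable_pi_iff.2 fun i => ?_
  unfold stickBreaking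
  fun_prop

/-- Cut `[0, 1)` from the right into pieces of lengths `stickBreaking w 0, stickBreaking w 1, …`.
This is the index of the piece that contains `u`, replaced by `m` if it is larger than `m` (or if
`u` lies in no piece). -/
noncomputable def pick (w : ℕ → ℝ) (m : ℕ) (u : ℝ) : ℕ :=
  ∑ i ∈ Finset.range m, if u < remaining w (i + 1) then 1 else 0

theorem pick_le (w : ℕ → ℝ) (m : ℕ) (u : ℝ) : pick w m u ≤ m := by
  unfold pick
  refine (Finset.sum_le_card_nsmul _ _ 1 fun i _ => ?_).trans (by simp)
  split_ifs <;> simp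

theorem measurable_pick (m : ℕ) : Measurable fun p : (ℕ → ℝ) × ℝ => pick p.1 m p.2 := by
  unfold pick
  refine Finset.measurable_sum _ fun i _ => Measurable.ite ?_ measurable_const measurable_const
  exact measurableSet_lt measurable_snd ((measurable_remaining (i + 1)).comp measurable_fst)

theorem pick_eq_of_mem {w : ℕ → ℝ} (hw : ∀ i, 0 ≤ w i ∧ w i ≤ 1) {m i : ℕ} {u : ℝ} (hi : i < m)
    (h1 : remaining w (i + 1) ≤ u) (h2 : u < remaining w i) : pick w m u = i := by
  have : (Finset.range m).filter (fun j => u < remaining w (j + 1)) = Finset.range i := by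
    ext j
    simp only [Finset.mem_filter, Finset.mem_range]
    constructor
    · rintro ⟨-, hj⟩
      by_contra! hij
      have := remaining_antitone hw (show i + 1 ≤ j + 1 by omega)
      linarith
    · intro hj
      exact ⟨by omega, h2.trans_le (remaining_antitone hw (show j + 1 ≤ i by omega))⟩
  rw [pick, ← Finset.card_filter, this, Finset.card_range]

theorem pick_eq_self_of_lt {w : ℕ → ℝ} (hw : ∀ i, 0 ≤ w i ∧ w i ≤ 1) {m : ℕ} {u : ℝ}
    (h : u < remaining w m) : pick w m u = m := by
  have : (Finset.range m).filter (fun j => u < remaining w (j + 1)) = Finset.range m := by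
    refine Finset.filter_true_of_mem fun j hj => ?_
    have := Finset.mem_range.1 hj
    exact h.trans_le (remaining_antitone hw (show j + 1 ≤ m by omega))
  rw [pick, ← Finset.card_filter, this, Finset.card_range]

theorem pick_eq_iff {w : ℕ → ℝ} (hw : ∀ i, 0 ≤ w i ∧ w i ≤ 1) {m i : ℕ} {u : ℝ} (hu : u < 1) :
    pick w m u = i ↔
      (i < m ∧ remaining w (i + 1) ≤ u ∧ u < remaining w i) ∨ (i = m ∧ u < remaining w m) := by
  constructor
  · intro h
    by_cases hm : u < remaining w m
    · right
      rw [pick_eq_self_of_lt hw hm] at h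
      exact ⟨h.symm, hm⟩
    · left
      have hex : ∃ j, remaining w j ≤ u := ⟨m, not_lt.1 hm⟩
      have h0 : Nat.find hex ≠ 0 := fun h0 => by
        have := Nat.find_spec hex
        rw [h0, remaining_zero] at this
        linarith
      obtain ⟨j, hj⟩ := Nat.exists_eq_succ_of_ne_zero h0
      have h1 : remaining w (j + 1) ≤ u := by
        have := Nat.find_spec hex
        rwa [hj] at this
      have h2 : u < remaining w j := not_le.1 (Nat.find_min hex (by omega))
      have h3 : j < m := by
        have := Nat.find_min' hex (not_lt.1 hm)
        omega
      rw [pick_eq_of_mem hw h3 h1 h2] at h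
      exact h ▸ ⟨h3, h1, h2⟩
  · rintro (⟨h1, h2, h3⟩ | ⟨rfl, h⟩)
    · exact pick_eq_of_mem hw h1 h2 h3
    · exact pick_eq_self_of_lt hw h

/-- The uniform distribution on `[0, 1)`. -/
noncomputable def uniform : Measure ℝ := volume.restrict (Set.Ico 0 1)

instance : IsProbabilityMeasure uniform := ⟨by simp [uniform]⟩

/-- The probability of `pick w m = i` under the uniform distribution. -/
noncomputable def pickProb (w : ℕ → ℝ) (m i : ℕ) : ℝ :=
  if i < m then stickBreaking w i else if i = m then remaining w m else 0

theorem uniform_real_pick {w : ℕ → ℝ} (hw : ∀ i, 0 ≤ w i ∧ w i ≤ 1) (m i : ℕ) :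
    uniform.real {u | pick w m u = i} = pickProb w m i := by
  have hmeas : MeasurableSet {u | pick w m u = i} :=
    ((measurable_pick m).comp measurable_prodMk_left) (measurableSet_singleton i)
  have hle : ∀ j, remaining w j ≤ 1 := fun j => by
    rw [← remaining_zero w]
    exact remaining_antitone hw (Nat.zero_le j)
  rw [measureReal_def, uniform, Measure.restrict_apply hmeas]
  unfold pickProb
  split_ifs with h1 h2
  · have : {u | pick w m u = i} ∩ Set.Ico 0 1
        = Set.Ico (remaining w (i + 1)) (remaining w i) := by
      ext u
      simp only [Set.mem_inter_iff, Set.mem_ofPred_eq, Set.mem_Ico]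
      constructor
      · rintro ⟨h, -, hu⟩
        rw [pick_eq_iff hw hu] at h
        rcases h with h | h
        · exact h.2
        · omega
      · rintro ⟨ha, hb⟩
        exact ⟨pick_eq_of_mem hw h1 ha hb, (remaining_nonneg hw _).trans ha, hb.trans_le (hle _)⟩
    rw [this, Real.volume_Ico, stickBreaking_eq_sub, ENNReal.toReal_ofReal]
    exact sub_nonneg.2 (remaining_antitone hw i.le_succ)
  · have : {u | pick w m u = i} ∩ Set.Ico 0 1 = Set.Ico 0 (remaining w m) := by
      ext u
      simp only [Set.mem_inter_iff, Set.mem_ofPred_eq, Set.mem_Ico]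
      constructor
      · rintro ⟨h, h0, hu⟩
        rw [pick_eq_iff hw hu] at h
        rcases h with h | h
        · omega
        · exact ⟨h0, h.2⟩
      · rintro ⟨ha, hb⟩
        exact ⟨(pick_eq_self_of_lt hw hb).trans h2.symm, ha, hb.trans_le (hle _)⟩
    rw [this, Real.volume_Ico, sub_zero, ENNReal.toReal_ofReal (remaining_nonneg hw m)]
  · have : {u | pick w m u = i} ∩ Set.Ico 0 1 = ∅ := by
      ext u
      simp only [Set.mem_inter_iff, Set.mem_ofPred_eq, Set.mem_empty_iff_false, iff_false, not_and]
      intro h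
      have := pick_le w m u
      omega
    rw [this]
    simp

/-- The number of labels in use after `n` steps of the sampling. -/
noncomputable def sampleCount (w u : ℕ → ℝ) : ℕ → ℕ
  | 0 => 0
  | n + 1 => max (sampleCount w u n) (pick w (sampleCount w u n) (u n) + 1)

/-- Sampling from the sticks: customer `n` has the label of the piece that contains `u n` if that
label is already in use, and the smallest unused label otherwise. -/
noncomputable def sample (w u : ℕ → ℝ) (n : ℕ) : ℕ := pick w (sampleCount w u n) (u n)

theorem restrictedGrowth_sample_and (w u : ℕ → ℝ) (n : ℕ) :
    RestrictedGrowth (sample w u) n ∧ numTables (sample w u) n = sampleCount w u n := by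
  induction n with
  | zero => exact ⟨fun c hc => absurd hc (by omega), by simp [numTables, sampleCount]⟩
  | succ n ih =>
    have hg : RestrictedGrowth (sample w u) (n + 1) := fun c hc => by
      rcases Nat.lt_succ_iff_lt_or_eq.1 hc with h | rfl
      · exact ih.1 c h
      · rw [ih.2]
        exact pick_le _ _ _
    refine ⟨hg, ?_⟩
    rw [hg.numTables_succ, ih.2]
    rfl

theorem restrictedGrowth_sample (w u : ℕ → ℝ) (n : ℕ) : RestrictedGrowth (sample w u) n :=
  (restrictedGrowth_sample_and w u n).1

theorem numTables_sample (w u : ℕ → ℝ) (n : ℕ) : numTables (sample w u) n = sampleCount w u n :=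
  (restrictedGrowth_sample_and w u n).2

theorem measurable_sample : Measurable fun p : (ℕ → ℝ) × (ℕ → ℝ) => sample p.1 p.2 := by
  have hpick : ∀ n (f : (ℕ → ℝ) × (ℕ → ℝ) → ℕ), Measurable f →
      Measurable fun p : (ℕ → ℝ) × (ℕ → ℝ) => pick p.1 (f p) (p.2 n) := fun n f hf => by
    have h1 : Measurable fun q : ((ℕ → ℝ) × ℝ) × ℕ => pick q.1.1 q.2 q.1.2 :=
      measurable_from_prod_countable_left fun m => measurable_pick m
    exact h1.comp ((measurable_fst.prodMk ((measurable_pi_apply n).comp measurable_snd)).prodMk hf)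
  have hcount : ∀ n, Measurable fun p : (ℕ → ℝ) × (ℕ → ℝ) => sampleCount p.1 p.2 n := fun n => by
    induction n with
    | zero => exact measurable_const
    | succ n ih => exact ih.max ((hpick n _ ih).add_const 1)
  exact measurable_pi_iff.2 fun n => hpick n _ (hcount n)

/-- The event that the first `n` sampled labels are given by `y` is a box in the variables `u`. -/
theorem cylinderEvent_sample (w : ℕ → ℝ) (n : ℕ) (y : ℕ → ℕ) :
    cylinderEvent (sample w) n y
      = Set.pi (Finset.range n) fun c => {v | pick w (numTables y c) v = y c} := by
  ext u
  simp only [cylinderEvent, Set.mem_ofPred_eq, Set.mem_pi, Finset.coe_range, Set.mem_Iio]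
  constructor
  · intro h c hc
    rw [← h c hc, sample, ← numTables_sample, numTables_congr fun d hd => h d (hd.trans hc)]
  · intro h c
    induction c using Nat.strong_induction_on with
    | _ c ih =>
      intro hc
      rw [sample, ← numTables_sample, numTables_congr fun d hd => ih d hd (hd.trans hc), h c hc]

theorem infinitePi_uniform_cylinderEvent {w : ℕ → ℝ} (hw : ∀ i, 0 ≤ w i ∧ w i ≤ 1) (n : ℕ)
    (y : ℕ → ℕ) :
    (Measure.infinitePi fun _ : ℕ => uniform).real (cylinderEvent (sample w) n y)
      = ∏ c ∈ Finset.range n, pickProb w (numTables y c) (y c) := by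
  rw [cylinderEvent_sample, measureReal_def, Measure.infinitePi_pi, ENNReal.toReal_prod]
  · exact Finset.prod_congr rfl fun c _ => uniform_real_pick hw _ _
  · exact fun c _ => ((measurable_pick _).comp measurable_prodMk_left) (measurableSet_singleton _)

/-- The conditional probability of the labels `y`, collected by stick-breaking factors: a customer
with an old label `l` contributes
`w l * ∏ j < l, (1 - w j)`, and a customer with the new label `l` contributes
`∏ j < l, (1 - w j)`. -/
theorem prod_pickProb {w : ℕ → ℝ} {K : ℕ} {y : ℕ → ℕ} {n : ℕ} (hy : RestrictedGrowth y n)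
    (hK : numTables y n ≤ K) :
    ∏ c ∈ Finset.range n, pickProb w (numTables y c) (y c)
      = ∏ i ∈ Finset.range K,
        (w i ^ (tableSize y n i - 1) * (1 - w i) ^ tailSize y n (i + 1)) := by
  induction n with
  | zero => simp [tableSize, tailSize]
  | succ n ih =>
    have hlK : y n < K := (hy.lt_numTables (by omega)).trans_le hK
    rw [Finset.prod_range_succ, ih hy.of_succ ((numTables_mono y n.le_succ).trans hK)]
    have hlast : pickProb w (numTables y n) (y n)
        = ∏ i ∈ Finset.range K, ((if i = y n then if y n < numTables y n then w i else 1 else 1)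
          * if i < y n then 1 - w i else 1) := by
      rw [Finset.prod_mul_distrib, prod_range_ite_lt hlK.le, Finset.prod_ite_eq',
        if_pos (Finset.mem_range.2 hlK)]
      unfold pickProb
      split_ifs with h1 h2
      · rfl
      · rw [one_mul, h2, remaining]
      · have := hy n (by omega)
        omega
    rw [hlast, ← Finset.prod_mul_distrib]
    refine Finset.prod_congr rfl fun i _ => ?_
    rw [hy.tableSize_sub_one_succ, tailSize_succ, pow_add, pow_add]
    simp only [Nat.add_one_le_iff]
    rcases lt_trichotomy i (y n) with h | h | h
    · simp [h, h.ne]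
      ring
    · simp only [h, lt_self_iff_false, if_true, if_false, true_and, mul_one, pow_zero]
      split_ifs
      · ring
      · ring
    · simp [h.ne', h.not_gt]

/-! ### The law of the sampled labels -/

/-- The law of the sequence of independent stick-breaking factors. -/
noncomputable def stickLaw (α θ : ℝ) : Measure (ℕ → ℝ) :=
  Measure.infinitePi fun j : ℕ => betaLaw (1 - α) (θ + ((j : ℝ) + 1) * α)

instance (α θ : ℝ) : IsProbabilityMeasure (stickLaw α θ) := by unfold stickLaw; infer_instance

theorem ae_stickLaw {α θ : ℝ} {p : ℕ → ℝ → Prop}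
    (h : ∀ j : ℕ, ∀ᵐ x ∂betaLaw (1 - α) (θ + ((j : ℝ) + 1) * α), p j x) :
    ∀ᵐ w ∂stickLaw α θ, ∀ j, p j (w j) := by
  rw [ae_all_iff]
  intro j
  exact (measurePreserving_eval_infinitePi
    (fun j : ℕ => betaLaw (1 - α) (θ + ((j : ℝ) + 1) * α)) j).quasiMeasurePreserving.ae (h j)

theorem ae_stickLaw_mem (α θ : ℝ) : ∀ᵐ w ∂stickLaw α θ, ∀ j, 0 ≤ w j ∧ w j ≤ 1 :=
  ae_stickLaw fun _ => ae_betaLaw_mem _ _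

theorem integral_stickLaw_prod (α θ : ℝ) (K : ℕ) (p q : ℕ → ℕ) :
    ∫ w, ∏ i ∈ Finset.range K, (w i ^ p i * (1 - w i) ^ q i) ∂stickLaw α θ
      = ∏ i ∈ Finset.range K, betaMoment (1 - α) (θ + ((i : ℝ) + 1) * α) (p i) (q i) := by
  let F : (Finset.range K → ℝ) → ℝ := fun v => ∏ i, (v i ^ p i * (1 - v i) ^ q i)
  have h1 : ∀ w : ℕ → ℝ, ∏ i ∈ Finset.range K, (w i ^ p i * (1 - w i) ^ q i)
      = F ((Finset.range K).restrict w) := fun w => by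
    rw [← Finset.prod_coe_sort]
    rfl
  simp_rw [h1]
  rw [stickLaw, integral_restrict_infinitePi (X := fun _ => ℝ) (f := F)
      (μ := fun j : ℕ => betaLaw (1 - α) (θ + ((j : ℝ) + 1) * α)) (by fun_prop),
    integral_fintype_prod_eq_prod (fun (i : Finset.range K) (x : ℝ) => x ^ p i * (1 - x) ^ q i)]
  exact Finset.prod_coe_sort (Finset.range K)
    fun i => betaMoment (1 - α) (θ + ((i : ℝ) + 1) * α) (p i) (q i)

/-- The joint law of the stick-breaking factors and the uniform variables used for sampling. -/
noncomputable def sampleSpace (α θ : ℝ) : Measure ((ℕ → ℝ) × (ℕ → ℝ)) :=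
  (stickLaw α θ).prod (Measure.infinitePi fun _ => uniform)

instance (α θ : ℝ) : IsProbabilityMeasure (sampleSpace α θ) := by
  unfold sampleSpace; infer_instance

/-- The sampled labels as a random sequence. -/
noncomputable def samples (p : (ℕ → ℝ) × (ℕ → ℝ)) : ℕ → ℕ := sample p.1 p.2

theorem sampleSpace_cylinderEvent (α θ : ℝ) {K n : ℕ} {y : ℕ → ℕ} (hy : RestrictedGrowth y n)
    (hK : numTables y n ≤ K) :
    (sampleSpace α θ).real (cylinderEvent samples n y) = cylinderProb α θ K y n := by
  have hmeas := measurableSet_cylinderEvent measurable_sample n y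
  rw [measureReal_def, sampleSpace]
  refine (congrArg ENNReal.toReal (Measure.prod_apply hmeas)).trans ?_
  rw [← integral_toReal (measurable_measure_prodMk_left hmeas).aemeasurable
    (Eventually.of_forall fun _ => measure_lt_top _ _), cylinderProb, ← integral_stickLaw_prod]
  refine integral_congr_ae ?_
  filter_upwards [ae_stickLaw_mem α θ] with w hw
  rw [← prod_pickProb hy hK, ← infinitePi_uniform_cylinderEvent hw]
  rfl

/-- The events `cylinderEvent Y n y` determine the law of a random sequence `Y` of integers. -/
theorem map_eq_of_cylinderEvent {Ω Ω' : Type*} [MeasurableSpace Ω] [MeasurableSpace Ω']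
    {μ : Measure Ω} {ν : Measure Ω'} [IsProbabilityMeasure μ] [IsProbabilityMeasure ν]
    {Y : Ω → ℕ → ℕ} {Z : Ω' → ℕ → ℕ} (hY : Measurable Y) (hZ : Measurable Z)
    (h : ∀ n y, μ.real (cylinderEvent Y n y) = ν.real (cylinderEvent Z n y)) :
    μ.map Y = ν.map Z := by
  have : IsProbabilityMeasure (μ.map Y) := Measure.isProbabilityMeasure_map hY.aemeasurable
  have : IsProbabilityMeasure (ν.map Z) := Measure.isProbabilityMeasure_map hZ.aemeasurable
  let P : (I : Finset ℕ) → Measure (Π _ : I, ℕ) := fun I => (ν.map Z).map I.restrict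
  have hP : IsProjectiveMeasureFamily (α := fun _ => ℕ) P := by
    intro I J hJI
    rw [Measure.map_map (by fun_prop) (by fun_prop)]
    rfl
  have (I : Finset ℕ) : IsFiniteMeasure (P I) := by
    simp only [P]
    infer_instance
  refine IsProjectiveLimit.unique (P := P) ?_ fun I => rfl
  rw [isProjectiveLimit_nat_iff hP]
  intro n
  refine Measure.ext_of_singleton fun t => ?_
  let y : ℕ → ℕ := fun c => if hc : c ≤ n then t ⟨c, Finset.mem_Iic.2 hc⟩ else 0
  have key : ∀ f : ℕ → ℕ, Preorder.frestrictLe n f = t ↔ ∀ c < n + 1, f c = y c := fun f => by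
    rw [funext_iff, Subtype.forall]
    constructor
    · intro hf c hc
      have hc' : c ≤ n := by omega
      have := hf c (Finset.mem_Iic.2 hc')
      simp only [y, dif_pos hc']
      exact this
    · intro hf c hc
      have hc' := Finset.mem_Iic.1 hc
      have := hf c (by omega)
      simp only [y, dif_pos hc'] at this
      exact this
  have hm : Measurable (Preorder.frestrictLe (π := fun _ : ℕ => ℕ) n) := by fun_prop
  have hl : (μ.map Y).map (Preorder.frestrictLe n) {t} = μ (cylinderEvent Y (n + 1) y) := by
    rw [Measure.map_map hm hY, Measure.map_apply (hm.comp hY) (measurableSet_singleton t)]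
    congr 1
    ext ω
    exact key (Y ω)
  have hr : P (Finset.Iic n) {t} = ν (cylinderEvent Z (n + 1) y) := by
    change (ν.map Z).map (Preorder.frestrictLe n) {t} = _
    rw [Measure.map_map hm hZ, Measure.map_apply (hm.comp hZ) (measurableSet_singleton t)]
    congr 1
    ext ω
    exact key (Z ω)
  rw [hl, hr]
  have := h (n + 1) y
  rwa [measureReal_def, measureReal_def,
    ENNReal.toReal_eq_toReal_iff' (measure_ne_top _ _) (measure_ne_top _ _)] at this

theorem cylinderEvent_eq_empty {Ω : Type*} {Y : Ω → ℕ → ℕ} {n : ℕ} {y : ℕ → ℕ}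
    (hY : ∀ ω, RestrictedGrowth (Y ω) n) (hy : ¬ RestrictedGrowth y n) :
    cylinderEvent Y n y = ∅ := by
  rw [Set.eq_empty_iff_forall_notMem]
  intro ω hω
  refine hy fun c hc => ?_
  rw [← hω c hc, ← numTables_congr fun d hd => hω d (hd.trans hc)]
  exact hY ω c hc

section Restaurant

variable {Ω : Type*} [MeasurableSpace Ω] {μ : Measure Ω} [IsProbabilityMeasure μ] {α θ : ℝ}
  {X : ℕ → Ω → ℕ}

/-- The exchangeable partition probability function of the restaurant, as a product of Beta
moments. -/
theorem IsChineseRestaurant.cylinderEvent_labels (hX : IsChineseRestaurant μ α θ X)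
    (hαθ : Admissible α θ) {K n : ℕ} (hn : 1 ≤ n) {y : ℕ → ℕ} (hy : RestrictedGrowth y n)
    (hK : numTables y n ≤ K) :
    μ.real (cylinderEvent (labels X) n y) = cylinderProb α θ K y n := by
  induction n, hn using Nat.le_induction with
  | base =>
    have h0 : y 0 = 0 := by simpa [numTables] using hy 0 one_pos
    rw [cylinderProb_one h0]
    have : cylinderEvent (labels X) 1 y = Set.univ := by
      ext ω
      have : labels X ω 0 = 0 := by simpa [numTables, labels] using label_le (fun c => X c ω) 0
      simp [cylinderEvent, h0, this]
    rw [this]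
    simp
  | succ n hn ih =>
    rw [hX.cylinder_step hn, cylinderProb_succ hαθ hn hy hK,
      ih hy.of_succ ((numTables_mono y n.le_succ).trans hK)]

/-- The labels of the restaurant have the same law as the labels sampled from random sticks. -/
theorem IsChineseRestaurant.map_labels (hX : IsChineseRestaurant μ α θ X)
    (hαθ : Admissible α θ) : μ.map (labels X) = (sampleSpace α θ).map samples := by
  refine map_eq_of_cylinderEvent (measurable_labels hX.measurable) measurable_sample fun n y => ?_
  rcases Nat.eq_zero_or_pos n with rfl | hn
  · have h1 : cylinderEvent (labels X) 0 y = Set.univ := by ext; simp [cylinderEvent]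
    have h2 : cylinderEvent samples 0 y = Set.univ := by ext; simp [cylinderEvent]
    rw [h1, h2]
    simp
  by_cases hy : RestrictedGrowth y n
  · rw [hX.cylinderEvent_labels hαθ hn hy le_rfl, sampleSpace_cylinderEvent α θ hy le_rfl]
  · rw [cylinderEvent_eq_empty (Y := labels X) (fun ω => restrictedGrowth_label _ n) hy,
      cylinderEvent_eq_empty (Y := samples) (fun p => restrictedGrowth_sample p.1 p.2 n) hy]
    simp

end Restaurant

/-! ### Asymptotic frequencies of the sampled labels -/

/-- The strong law of large numbers for the events `pick w m (u c) = i`. -/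
theorem ae_tendsto_pick {w : ℕ → ℝ} (hw : ∀ i, 0 ≤ w i ∧ w i ≤ 1) (m i : ℕ) :
    ∀ᵐ u ∂Measure.infinitePi fun _ : ℕ => uniform,
      Tendsto (fun n : ℕ => (tableSize (fun c => pick w m (u c)) n i : ℝ) / n) atTop
        (𝓝 (pickProb w m i)) := by
  have hE : MeasurableSet {v | pick w m v = i} :=
    ((measurable_pick m).comp measurable_prodMk_left) (measurableSet_singleton i)
  let g : ℝ → ℝ := Set.indicator {v | pick w m v = i} 1
  have hg : Measurable g := measurable_one.indicator hE
  have hint : Integrable g uniform := (integrable_const (1 : ℝ)).indicator hE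
  have hpres := fun c : ℕ => measurePreserving_eval_infinitePi (fun _ : ℕ => uniform) c
  have hind : iIndepFun (fun (c : ℕ) (u : ℕ → ℝ) => g (u c))
      (Measure.infinitePi fun _ : ℕ => uniform) := iIndepFun_infinitePi fun _ => hg
  have hident : ∀ c : ℕ, IdentDistrib (fun u : ℕ → ℝ => g (u c)) (fun u : ℕ → ℝ => g (u 0))
      (Measure.infinitePi fun _ : ℕ => uniform) (Measure.infinitePi fun _ : ℕ => uniform) :=
    fun c => IdentDistrib.comp
      ⟨(measurable_pi_apply c).aemeasurable, (measurable_pi_apply 0).aemeasurable,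
        (hpres c).map_eq.trans (hpres 0).map_eq.symm⟩ hg
  have hlln := strong_law_ae_real (fun (c : ℕ) (u : ℕ → ℝ) => g (u c))
    ((hpres 0).integrable_comp_of_integrable hint)
    (fun c d hcd => hind.indepFun hcd) hident
  have hmean : ∫ u : ℕ → ℝ, g (u 0) ∂(Measure.infinitePi fun _ : ℕ => uniform)
      = pickProb w m i := by
    rw [← uniform_real_pick hw, ← integral_indicator_one hE]
    have h := integral_map (measurable_pi_apply (0 : ℕ)).aemeasurable
      (μ := Measure.infinitePi fun _ : ℕ => uniform) (f := g) hg.aestronglyMeasurable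
    rw [show (fun u : ℕ → ℝ => u 0) = Function.eval 0 from rfl, (hpres 0).map_eq] at h
    exact h.symm
  rw [hmean] at hlln
  filter_upwards [hlln] with u hu
  refine hu.congr fun n => ?_
  congr 1
  simp [tableSize, g, Set.indicator_apply]

/-- Changing finitely many occurrences of `i` does not change its asymptotic frequency. -/
theorem tendsto_tableSize_congr {y z : ℕ → ℕ} {i : ℕ} {l : ℝ}
    (hyz : ∀ᶠ c in atTop, (y c = i ↔ z c = i))
    (hz : Tendsto (fun n : ℕ => (tableSize z n i : ℝ) / n) atTop (𝓝 l)) :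
    Tendsto (fun n : ℕ => (tableSize y n i : ℝ) / n) atTop (𝓝 l) := by
  obtain ⟨N, hN⟩ := eventually_atTop.1 hyz
  -- the counts differ by a constant from time `N` on
  have hconst : ∀ n ≥ N, (tableSize y n i : ℝ) - tableSize z n i
      = (tableSize y N i : ℝ) - tableSize z N i := fun n hn => by
    induction n, hn using Nat.le_induction with
    | base => rfl
    | succ n hn ih =>
      rw [tableSize_succ, tableSize_succ, ← ih]
      simp only [hN n hn]
      push_cast
      ring
  have h0 := tendsto_const_div_atTop_nhds_zero_nat ((tableSize y N i : ℝ) - tableSize z N i)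
  have := hz.add h0
  rw [add_zero] at this
  refine this.congr' ?_
  filter_upwards [eventually_ge_atTop N] with n hn
  rw [← hconst n hn]
  ring

/-- The points `u` are typical for the stick-breaking factors `w`: the event `pick w m (u c) = i`
occurs for a proportion `pickProb w m i` of the indices `c`, for all `m` and `i`. The factors are
required to lie in `[0, 1]` and the points to lie below `1`. -/
def HasFrequencies (w u : ℕ → ℝ) : Prop :=
  (∀ i, 0 ≤ w i ∧ w i ≤ 1) ∧ (∀ c, u c < 1) ∧ ∀ m i,
    Tendsto (fun n : ℕ => (tableSize (fun c => pick w m (u c)) n i : ℝ) / n) atTop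
      (𝓝 (pickProb w m i))

theorem sampleCount_mono (w u : ℕ → ℝ) : Monotone (sampleCount w u) :=
  monotone_nat_of_le_succ fun _ => le_max_left _ _

/-- If only `m` labels are ever used, then the first `m` pieces exhaust the stick: from some time
on all points lie in these pieces, so what remains has frequency zero. -/
theorem HasFrequencies.remaining_eq_zero {w u : ℕ → ℝ} (h : HasFrequencies w u) {B : ℕ}
    (hB : ∀ n, sampleCount w u n ≤ B) : ∃ m ≤ B, remaining w m = 0 := by
  obtain ⟨N, hN⟩ : ∃ N, ∀ n ≥ N, sampleCount w u n = sampleCount w u N := by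
    have hfin : (Set.range (sampleCount w u)).Finite :=
      (Set.finite_Iic B).subset (by rintro _ ⟨n, rfl⟩; exact hB n)
    obtain ⟨_, ⟨⟨N, rfl⟩, hmax⟩⟩ := hfin.exists_maximal (Set.range_nonempty _)
    exact ⟨N, fun n hn => le_antisymm (hmax ⟨n, rfl⟩ (sampleCount_mono w u hn))
      (sampleCount_mono w u hn)⟩
  refine ⟨sampleCount w u N, hB N, ?_⟩
  set m := sampleCount w u N
  have hpick : ∀ᶠ c in atTop, (pick w m (u c) = m ↔ (fun _ : ℕ => m + 1) c = m) := by
    filter_upwards [eventually_ge_atTop N] with n hn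
    have h1 : sampleCount w u (n + 1) = m := hN _ (by omega)
    rw [sampleCount, hN n hn] at h1
    constructor
    · intro h2
      omega
    · intro h2
      exact absurd h2 (by simp)
  have hz : Tendsto (fun n : ℕ => (tableSize (fun _ => m + 1) n m : ℝ) / n) atTop (𝓝 0) := by
    simp [tableSize]
  have := tendsto_nhds_unique (h.2.2 m m) (tendsto_tableSize_congr hpick hz)
  simpa [pickProb] using this

/-- The frequency of the label `i` is the length of the piece `i`. If the number of labels stays
bounded by `i`, then both are zero. -/
theorem HasFrequencies.tendsto_sample {w u : ℕ → ℝ} (h : HasFrequencies w u) (i : ℕ) :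
    Tendsto (fun n : ℕ => (tableSize (sample w u) n i : ℝ) / n) atTop
      (𝓝 (stickBreaking w i)) := by
  by_cases hB : ∀ n, sampleCount w u n ≤ i
  · obtain ⟨m, hm, hR⟩ := h.remaining_eq_zero hB
    have hRi : remaining w i = 0 :=
      le_antisymm (hR ▸ remaining_antitone h.1 hm) (remaining_nonneg h.1 i)
    have hstick : stickBreaking w i = 0 := by
      rw [stickBreaking_eq_sub, remaining_succ, hRi]
      simp
    have hzero : ∀ n, tableSize (sample w u) n i = 0 := fun n =>
      (restrictedGrowth_sample w u n).tableSize_eq_zero (by rw [numTables_sample]; exact hB n)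
    simp [hstick, hzero]
  · push Not at hB
    obtain ⟨N, hN⟩ := hB
    have hlim := h.2.2 (i + 1) i
    rw [pickProb, if_pos (by omega)] at hlim
    refine tendsto_tableSize_congr ?_ hlim
    filter_upwards [eventually_ge_atTop N] with n hn
    have hlt : i < sampleCount w u n := hN.trans_le (sampleCount_mono w u hn)
    rw [sample, pick_eq_iff h.1 (h.2.1 n), pick_eq_iff h.1 (h.2.1 n)]
    simp [hlt, hlt.ne]

theorem HasFrequencies.exists_sample_eq {w u : ℕ → ℝ} (h : HasFrequencies w u)
    (hw : ∀ i, w i < 1) (i : ℕ) : ∃ c, sample w u c = i := by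
  have hR : ∀ m, remaining w m ≠ 0 := fun m =>
    (Finset.prod_pos fun j _ => sub_pos.2 (hw j)).ne'
  have hB : ¬ ∀ n, sampleCount w u n ≤ i := fun hB => by
    obtain ⟨m, -, hm⟩ := h.remaining_eq_zero hB
    exact hR m hm
  push Not at hB
  obtain ⟨n, hn⟩ := hB
  have h1 := (restrictedGrowth_sample w u n).tableSize_pos (i := i) (by rwa [numTables_sample])
  obtain ⟨c, hc⟩ := Finset.card_pos.1 h1
  exact ⟨c, (Finset.mem_filter.1 hc).2⟩

theorem ae_hasFrequencies (α θ : ℝ) : ∀ᵐ p ∂sampleSpace α θ, HasFrequencies p.1 p.2 := by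
  have h1 : ∀ᵐ p ∂sampleSpace α θ, ∀ i, 0 ≤ p.1 i ∧ p.1 i ≤ 1 :=
    Measure.quasiMeasurePreserving_fst.ae (ae_stickLaw_mem α θ)
  have h2 : ∀ᵐ p ∂sampleSpace α θ, ∀ c, p.2 c < 1 := by
    refine Measure.quasiMeasurePreserving_snd.ae (p := fun u : ℕ → ℝ => ∀ c, u c < 1) ?_
    rw [ae_all_iff]
    intro c
    refine (measurePreserving_eval_infinitePi
      (fun _ : ℕ => uniform) c).quasiMeasurePreserving.ae (p := fun x => x < 1) ?_
    exact (ae_restrict_mem measurableSet_Ico).mono fun x hx => hx.2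
  have h3 : ∀ᵐ p ∂sampleSpace α θ, ∀ m i,
      Tendsto (fun n : ℕ => (tableSize (fun c => pick p.1 m (p.2 c)) n i : ℝ) / n) atTop
        (𝓝 (pickProb p.1 m i)) := by
    rw [ae_all_iff]
    intro m
    rw [ae_all_iff]
    intro i
    have hmeas : MeasurableSet {p : (ℕ → ℝ) × (ℕ → ℝ) |
        Tendsto (fun n : ℕ => (tableSize (fun c => pick p.1 m (p.2 c)) n i : ℝ) / n) atTop
        (𝓝 (pickProb p.1 m i))} := by
      refine measurableSet_tendsto_fun (fun n => ?_) ?_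
      · have hc : ∀ c : ℕ, MeasurableSet {p : (ℕ → ℝ) × (ℕ → ℝ) | pick p.1 m (p.2 c) = i} :=
          fun c => ((measurable_pick m).comp (measurable_fst.prodMk
            ((measurable_pi_apply c).comp measurable_snd))) (measurableSet_singleton i)
        simp only [tableSize, Finset.card_filter]
        push_cast
        exact (Finset.measurable_sum _ fun c _ =>
          Measurable.ite (hc c) measurable_const measurable_const).div_const _
      · unfold pickProb
        split_ifs
        · exact (measurable_pi_iff.1 measurable_stickBreaking i).comp measurable_fst
        · exact (measurable_remaining m).comp measurable_fst
        · exact measurable_const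
    refine (Measure.ae_prod_iff_ae_ae hmeas).2 ?_
    filter_upwards [ae_stickLaw_mem α θ] with w hw
    exact ae_tendsto_pick hw m i
  filter_upwards [h1, h2, h3] with p a b c using ⟨a, b, c⟩

/-! ### Transfer to the restaurant -/

/-- The asymptotic frequency of `i` in the sequence `z`, as a limit superior, which makes it a
measurable function of `z`. -/
noncomputable def frequency (z : ℕ → ℕ) (i : ℕ) : ℝ :=
  limsup (fun n : ℕ => (tableSize z n i : ℝ) / n) atTop

theorem measurable_tableSize_div (n i : ℕ) :
    Measurable fun z : ℕ → ℕ => (tableSize z n i : ℝ) / n := by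
  simp only [tableSize, Finset.card_filter]
  push_cast
  refine (Finset.measurable_sum _ fun c _ =>
    Measurable.ite ?_ measurable_const measurable_const).div_const _
  exact measurableSet_eq_fun (measurable_pi_apply c) measurable_const

theorem measurable_frequency : Measurable frequency :=
  measurable_pi_iff.2 fun i => Measurable.limsup fun n => measurable_tableSize_div n i

/-- Every value has an asymptotic frequency in `z`. -/
def FrequenciesExist (z : ℕ → ℕ) : Prop :=
  ∀ i, Tendsto (fun n : ℕ => (tableSize z n i : ℝ) / n) atTop (𝓝 (frequency z i))

theorem measurableSet_frequenciesExist : MeasurableSet {z | FrequenciesExist z} := by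
  simp only [FrequenciesExist, Set.ofPred_forall]
  exact MeasurableSet.iInter fun i => measurableSet_tendsto_fun
    (fun n => measurable_tableSize_div n i) (measurable_pi_iff.1 measurable_frequency i)

theorem HasFrequencies.frequency_sample {w u : ℕ → ℝ} (h : HasFrequencies w u) :
    frequency (sample w u) = stickBreaking w :=
  funext fun i => (h.tendsto_sample i).limsup_eq

theorem HasFrequencies.frequenciesExist {w u : ℕ → ℝ} (h : HasFrequencies w u) :
    FrequenciesExist (sample w u) := fun i => by
  rw [h.frequency_sample]
  exact h.tendsto_sample i

theorem proportion_block (s : ℕ → ℕ) (i : ℕ) :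
    proportion (block (Setoid.ker s) i) = fun n : ℕ => (tableSize (label s) n i : ℝ) / n := by
  rw [block_ker_eq]
  exact funext fun n => proportion_setOf_eq _ _ _

theorem FrequenciesExist.weight_block {s : ℕ → ℕ} (h : FrequenciesExist (label s)) (i : ℕ) :
    weight (block (Setoid.ker s) i) = frequency (label s) i := by
  rw [weight, proportion_block]
  exact (h i).limUnder_eq

/-- The blocks of the partition into tables are the classes of customers with a common label. -/
theorem exists_block_of_mem_classes {s : ℕ → ℕ} {B : Set ℕ} (hB : B ∈ (Setoid.ker s).classes) :
    ∃ i, B = block (Setoid.ker s) i := by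
  obtain ⟨d, rfl⟩ := hB
  refine ⟨label s d, ?_⟩
  rw [block_ker_eq]
  ext c
  simp only [Set.mem_ofPred_eq, Setoid.ker_def, label_eq_iff]

theorem infinite_classes_of_labels {s : ℕ → ℕ} (h : ∀ i, ∃ c, label s c = i) :
    (Setoid.ker s).classes.Infinite := by
  choose f hf using h
  refine Set.infinite_of_injective_forall_mem (f := fun i => {x | Setoid.ker s x (f i)}) ?_
    fun i => Setoid.mem_classes _ _
  intro i j hij
  have : f i ∈ {x | Setoid.ker s x (f j)} := by
    rw [← show {x | Setoid.ker s x (f i)} = {x | Setoid.ker s x (f j)} from hij]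
    exact rfl
  rw [← hf i, ← hf j]
  exact label_eq_of_eq this

section Restaurant

variable {Ω : Type*} [MeasurableSpace Ω] {μ : Measure Ω} [IsProbabilityMeasure μ] {α θ : ℝ}
  {X : ℕ → Ω → ℕ}

/-- An almost sure property of the sampled labels holds almost surely for the restaurant. -/
theorem IsChineseRestaurant.ae_labels (hX : IsChineseRestaurant μ α θ X) (hαθ : Admissible α θ)
    {p : (ℕ → ℕ) → Prop} (hp : MeasurableSet {z | p z})
    (h : ∀ᵐ q ∂sampleSpace α θ, p (sample q.1 q.2)) : ∀ᵐ ω ∂μ, p (labels X ω) := by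
  refine ae_of_ae_map (measurable_labels hX.measurable).aemeasurable ?_
  rw [hX.map_labels hαθ]
  exact (ae_map_iff measurable_sample.aemeasurable hp).2 h

theorem IsChineseRestaurant.ae_frequenciesExist (hX : IsChineseRestaurant μ α θ X)
    (hαθ : Admissible α θ) : ∀ᵐ ω ∂μ, FrequenciesExist (labels X ω) :=
  hX.ae_labels hαθ measurableSet_frequenciesExist
    ((ae_hasFrequencies α θ).mono fun _ h => h.frequenciesExist)

/-- The frequencies of the labels have the law of the stick-breaking sequence. -/
theorem IsChineseRestaurant.identDistrib_frequency (hX : IsChineseRestaurant μ α θ X)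
    (hαθ : Admissible α θ) :
    IdentDistrib (fun ω => frequency (labels X ω)) (fun w => stickBreaking w) μ
      (stickLaw α θ) := by
  have h1 : IdentDistrib (labels X) samples μ (sampleSpace α θ) :=
    ⟨(measurable_labels hX.measurable).aemeasurable, measurable_sample.aemeasurable,
      hX.map_labels hαθ⟩
  have h2 : IdentDistrib (fun q => frequency (samples q)) (fun q => stickBreaking q.1)
      (sampleSpace α θ) (sampleSpace α θ) :=
    IdentDistrib.of_ae_eq (measurable_frequency.comp measurable_sample).aemeasurable
      ((ae_hasFrequencies α θ).mono fun _ h => h.frequency_sample)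
  have h3 : IdentDistrib Prod.fst id (sampleSpace α θ) (stickLaw α θ) :=
    ⟨measurable_fst.aemeasurable, aemeasurable_id, by
      rw [Measure.map_id]
      exact measurePreserving_fst.map_eq⟩
  exact ((h1.comp measurable_frequency).trans h2).trans (h3.comp measurable_stickBreaking)

end Restaurant

end CRP

theorem mainTheorem4 {Ω : Type*} [MeasurableSpace Ω] (μ : MeasureTheory.Measure Ω)
    [MeasureTheory.IsProbabilityMeasure μ] (α θ : ℝ) (hαθ : CRP.Admissible α θ)
    (X : ℕ → Ω → ℕ) (hX : CRP.IsChineseRestaurant μ α θ X) :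
    -- almost surely, all the limits defining the block weights exist
    (∀ᵐ ω ∂μ, ∀ i : ℕ,
      Filter.Tendsto (CRP.proportion (CRP.block (CRP.partition X ω) i)) Filter.atTop
        (nhds (CRP.weight (CRP.block (CRP.partition X ω) i)))) ∧
    -- the sequence of the weights has the law of the stick-breaking sequence
    (∀ (Ω' : Type*) [MeasurableSpace Ω'] (P : MeasureTheory.Measure Ω')
      [MeasureTheory.IsProbabilityMeasure P] (W : ℕ → Ω' → ℝ),
      ProbabilityTheory.iIndepFun W P →
      (∀ j : ℕ, ProbabilityTheory.HasLaw (W j)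
        (CRP.betaLaw (1 - α) (θ + ((j : ℝ) + 1) * α)) P) →
      ProbabilityTheory.IdentDistrib
        (fun ω => fun i : ℕ => CRP.weight (CRP.block (CRP.partition X ω) i))
        (fun ω' => CRP.stickBreaking fun j => W j ω') μ P) ∧
    -- if `0 ≤ α ≤ 1`, there are infinitely many blocks, and they have positive weights if `α < 1`
    (0 ≤ α → ∀ᵐ ω ∂μ, (CRP.partition X ω).classes.Infinite) ∧
    (0 ≤ α → α < 1 → ∀ᵐ ω ∂μ, ∀ B ∈ (CRP.partition X ω).classes,
      ∃ v : ℝ, 0 < v ∧ Filter.Tendsto (CRP.proportion B) Filter.atTop (nhds v)) := by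
  have hfreq := hX.ae_frequenciesExist hαθ
  -- for nonnegative `α`, no stick-breaking factor equals one
  have hlt : 0 ≤ α → ∀ᵐ w ∂CRP.stickLaw α θ, ∀ j, w j < 1 := fun h0 => by
    refine CRP.ae_stickLaw fun j => CRP.ae_betaLaw_lt_one ?_
    rcases hαθ with ⟨hα, -⟩ | ⟨-, -, hθ⟩
    · linarith
    · have : (0 : ℝ) ≤ j * α := by positivity
      linarith
  refine ⟨?_, ?_, ?_, ?_⟩
  · filter_upwards [hfreq] with ω hω i
    rw [CRP.partition, hω.weight_block, CRP.proportion_block]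
    exact hω i
  · intro Ω' _ P _ W hW hlaw
    have hWlaw : ProbabilityTheory.HasLaw (fun ω' j => W j ω') (CRP.stickLaw α θ) P :=
      hW.hasLaw_infinitePi hlaw (aemeasurable_pi_iff.2 fun j => (hlaw j).aemeasurable)
    have h1 : ProbabilityTheory.IdentDistrib id (fun ω' j => W j ω') (CRP.stickLaw α θ) P :=
      ⟨aemeasurable_id, hWlaw.aemeasurable, by rw [MeasureTheory.Measure.map_id, hWlaw.map_eq]⟩
    have h2 := (hX.identDistrib_frequency hαθ).trans (h1.comp CRP.measurable_stickBreaking)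
    refine (ProbabilityTheory.IdentDistrib.of_ae_eq h2.aemeasurable_fst ?_).symm.trans h2
    filter_upwards [hfreq] with ω hω
    exact funext fun i => (hω.weight_block i).symm
  · intro h0
    have hmeas : MeasurableSet {z : ℕ → ℕ | ∀ i, ∃ c, z c = i} := by
      simp only [Set.ofPred_forall, Set.ofPred_exists]
      exact MeasurableSet.iInter fun i => MeasurableSet.iUnion fun c =>
        measurableSet_eq_fun (measurable_pi_apply c) measurable_const
    have hall : ∀ᵐ ω ∂μ, ∀ i, ∃ c, CRP.labels X ω c = i := by
      refine hX.ae_labels hαθ hmeas ?_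
      filter_upwards [CRP.ae_hasFrequencies α θ,
        MeasureTheory.Measure.quasiMeasurePreserving_fst.ae (hlt h0)] with q hq hw
      exact hq.exists_sample_eq hw
    filter_upwards [hall] with ω hω
    exact CRP.infinite_classes_of_labels hω
  · intro h0 h1
    have hpos : ∀ᵐ w ∂CRP.stickLaw α θ, ∀ i, 0 < CRP.stickBreaking w i := by
      filter_upwards [hlt h0, CRP.ae_stickLaw fun j => CRP.ae_betaLaw_pos (sub_pos.2 h1)]
        with w hw hw' i
      exact mul_pos (hw' i) (Finset.prod_pos fun j _ => sub_pos.2 (hw j))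
    have hmeas : MeasurableSet {v : ℕ → ℝ | ∀ i, 0 < v i} := by
      simp only [Set.ofPred_forall]
      exact MeasurableSet.iInter fun i => measurableSet_lt measurable_const (measurable_pi_apply i)
    have hpos' := (hX.identDistrib_frequency hαθ).symm.ae_snd hmeas hpos
    filter_upwards [hfreq, hpos'] with ω hω hv B hB
    obtain ⟨i, rfl⟩ := CRP.exists_block_of_mem_classes hB
    refine ⟨CRP.frequency (CRP.labels X ω) i, hv i, ?_⟩
    rw [CRP.proportion_block]
    exact hω i
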